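/- **Terms and reduction.** $\lambda C$-terms are the pure $\lambda$-terms (up to renaming of bound variables) with one additional constant $C$. Write $(t)u$ for application and $(t)t_1\dots t_n$ for $(\dots((t)t_1)\dots)t_n$. Head $C$-reduction $\succ_C$ is the reflexive transitive closure of the two rules (applied to the whole term, $n\ge 0$) $$(\lambda x\,u)\,t\,t_1\dots t_n\to (u[t/x])\,t_1\dots t_n,\qquad (C)\,t\,t_1\dots t_n\to (t)\,\lambda x\,(x)\,t_1\dots t_n,$$ where in the second rule $x$ does not occur in $t_1,\dots,t_n$. **Types.** Fix a language with function symbols and predicate symbols, and a set $E$ of equations between its individual terms; $a\approx b$ means that $a=b$ is a consequence of $E$ (the variables of the equations being universally quantified). Types are the second order formulas built with $\bot$, $\to$ and $\forall$ from predicate symbols, and from predicate variables of every arity, which come in two kinds: ordinary variables $X$ and classical variables $X_C$; $\forall$ binds individual, ordinary predicate and classical predicate variables; $\neg A$ is $A\to\bot$. A type is classical if it ends with $\bot$ or with a classical variable: the type obtained by going to the right of all $\to$ and below all $\forall$ is $\bot$ or $X_C(a_1,\dots,a_k)$ for some classical variable $X_C$, free or bound. **The system M2.** The judgment $\Gamma\vdash_{M2}t:A$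 is given by the rules: (0) $\Gamma\vdash C:\forall X_C\{\neg\neg X_C\to X_C\}$, with $X_C$ of arity $0$; (1) $\Gamma\vdash x:A$ if $x:A$ is in $\Gamma$; (2) if $\Gamma,x:A\vdash t:B$, then $\Gamma\vdash\lambda x\,t:A\to B$; (3) if $\Gamma\vdash u:A\to B$ and $\Gamma\vdash v:A$, then $\Gamma\vdash (u)v:B$; (4) if $\Gamma\vdash t:A$ and the variable $v$ (individual, ordinary or classical) is not free in $\Gamma$, then $\Gamma\vdash t:\forall v\,A$; (5) if $\Gamma\vdash t:\forall x\,A$ with $x$ an individual variable, then $\Gamma\vdash t:A[a/x]$ for every individual term $a$; (6) if $\Gamma\vdash t:\forall X\,A$ with $X$ an ordinary variable, then $\Gamma\vdash t:A[G/X]$ for every formula $G$ (with as many distinguished individual variables as the arity of $X$); (7) if $\Gamma\vdash t:\forall X_C\,A$ with $X_C$ a classical variable, then $\Gamma\vdash t:A[G/X_C]$ for every classical type $G$ (likewise); (8) if $\Gamma\vdash t:A[a/x]$ and $a\approx b$, then $\Gamma\vdash t:A[b/x]$. **Theorem 7.2.** If $\vdash_{M2}T:\forall X_C\{\neg\neg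 X_C\to X_C\}$ (with $X_C$ of arity $0$), then there are integers $m\ge 1$ and $j\in\{1,\dots,m\}$ such that, for every integer $n\ge 0$, all $\lambda C$-terms $t,t_1,\dots,t_n$, and all distinct variables $y_1,\dots,y_m$ not free in $t,t_1,\dots,t_n$, there are $\lambda C$-terms $V_1,\dots,V_m$, such that $y_i,\dots,y_m$ are not free in $V_i$ for $1\le i\le m$, and - $(T)\,t\,t_1\dots t_n\succ_C (t)V_1$, - $(V_i)\,y_i\succ_C (t)V_{i+1}$ for $1\le i\le m-1$, - $(V_m)\,y_m\succ_C (y_j)\,t_1\dots t_n$. -/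

import Mathlib

namespace MixedLogic

/-! ### Pure lambda-C-terms, with de Bruijn indices -/

/-- The λC-terms: the pure λ-terms with one additional constant `cc` (written C).
Variables are de Bruijn indices, so terms are identified up to renaming of bound variables; an
index pointing outside all abstractions is a free variable. -/
inductive Tm : Type
  | var (i : ℕ) : Tm
  | cc : Tm
  | app (u v : Tm) : Tm
  | lam (u : Tm) : Tm

namespace Tm

/-- The iterated application `(t) t₁ … tₙ`. -/
def apps (t : Tm) (ts : List Tm) : Tm := ts.foldl app t

/-- Extend a renaming under a binder. -/
def liftRen (ρ : ℕ → ℕ) : ℕ → ℕ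
  | 0 => 0
  | i + 1 => ρ i + 1

def rename : (ℕ → ℕ) → Tm → Tm
  | ρ, var i => var (ρ i)
  | _, cc => cc
  | ρ, app u v => app (rename ρ u) (rename ρ v)
  | ρ, lam u => lam (rename (liftRen ρ) u)

/-- The term `t` placed under one more abstraction, whose variable does not occur in it. -/
def shift (t : Tm) : Tm := t.rename Nat.succ

/-- Extend a simultaneous substitution under a binder. -/
def liftSubst (σ : ℕ → Tm) : ℕ → Tm
  | 0 => var 0
  | i + 1 => (σ i).shift

/-- Simultaneous capture-avoiding substitution. -/
def subst : (ℕ → Tm) → Tm → Tm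
  | σ, var i => σ i
  | _, cc => cc
  | σ, app u v => app (subst σ u) (subst σ v)
  | σ, lam u => lam (subst (liftSubst σ) u)

/-- `u[t/x]`, where `x` is the variable with index `0` in `u`. -/
def inst (u t : Tm) : Tm :=
  u.subst fun
    | 0 => t
    | i + 1 => var i

/-- The variable with index `y` occurs free in the term. -/
def FreeIn : ℕ → Tm → Prop
  | y, var i => i = y
  | _, cc => False
  | y, app u v => FreeIn y u ∨ FreeIn y v
  | y, lam u => FreeIn (y + 1) u

end Tm

open Tm in
/-- One step of head C-reduction:
`(λx u) t t₁ … tₙ → (u[t/x]) t₁ … tₙ` and `(C) t t₁ … tₙ → (t) λx (x) t₁ … tₙ`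
(with `x` not occurring in `t₁, …, tₙ`). -/
inductive HeadStep : Tm → Tm → Prop
  | beta (u t : Tm) (ts : List Tm) :
      HeadStep (apps (app (lam u) t) ts) (apps (u.inst t) ts)
  | control (t : Tm) (ts : List Tm) :
      HeadStep (apps (app cc t) ts) (app t (lam (apps (var 0) (ts.map shift))))

/-- Head C-reduction `t ≻_C t'`: finitely many (possibly zero) steps. -/
def HeadRed : Tm → Tm → Prop := Relation.ReflTransGen HeadStep

/-! ### Types: second order formulas with ordinary and classical predicate variables -/

/-- The two kinds of second order variables. -/
inductive Kind : Type
  | ordinary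
  | classical
  deriving DecidableEq

universe u v

/-- Second order formulas over the language `L` (its function symbols build the individual terms,
its relation symbols are the predicate symbols). Bound variables are de Bruijn indices: there is
one series of indices for individual variables and one for the predicate variables of each
kind and arity. So `allInd` binds the individual index `0`, and `allPred k n` binds the
index `0` among the predicate variables of kind `k` and arity `n`. -/
inductive Formula (L : FirstOrder.Language.{u, v}) : Type (max u v)
  | bot : Formula L
  | rel {n : ℕ} (R : L.Relations n) (ts : Fin n → L.Term ℕ) : Formula L
  | pvar (k : Kind) (n : ℕ) (i : ℕ) (ts : Fin n → L.Term ℕ) : Formula L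
  | imp (A B : Formula L) : Formula L
  | allInd (A : Formula L) : Formula L
  | allPred (k : Kind) (n : ℕ) (A : Formula L) : Formula L

namespace Formula

variable {L : FirstOrder.Language.{u, v}}

/-- `¬ A` is `A → ⊥`. -/
def neg (A : Formula L) : Formula L := imp A bot

/-- A type is classical if it ends with `⊥` or with a classical variable (free or bound). -/
def IsClassical : Formula L → Prop
  | bot => True
  | rel _ _ => False
  | pvar k _ _ _ => k = Kind.classical
  | imp _ B => IsClassical B
  | allInd A => IsClassical A
  | allPred _ _ A => IsClassical A

/-- Extend a substitution of individual terms under an individual quantifier. -/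
def liftInd (σ : ℕ → L.Term ℕ) : ℕ → L.Term ℕ
  | 0 => FirstOrder.Language.Term.var 0
  | i + 1 => (σ i).relabel Nat.succ

/-- Simultaneous substitution of individual terms for individual variables. -/
def substInd : (ℕ → L.Term ℕ) → Formula L → Formula L
  | _, bot => bot
  | σ, rel R ts => rel R fun a => (ts a).subst σ
  | σ, pvar k n i ts => pvar k n i fun a => (ts a).subst σ
  | σ, imp A B => imp (substInd σ A) (substInd σ B)
  | σ, allInd A => allInd (substInd (liftInd σ) A)
  | σ, allPred k n A => allPred k n (substInd σ A)

/-- `A` placed under one more individual quantifier, whose variable is not free in it. -/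
def shiftInd (A : Formula L) : Formula L :=
  A.substInd fun i => FirstOrder.Language.Term.var (i + 1)

/-- `A[u/x]`, where `x` is the individual variable with index `0` in `A`. -/
def instInd (A : Formula L) (u : L.Term ℕ) : Formula L :=
  A.substInd fun
    | 0 => u
    | i + 1 => FirstOrder.Language.Term.var i

/-- Extend a renaming of predicate variables under a quantifier of kind `k` and arity `n`. -/
def liftPredRen (k : Kind) (n : ℕ) (ρ : Kind → ℕ → ℕ → ℕ) : Kind → ℕ → ℕ → ℕ :=
  fun k' n' i =>
    if k' = k ∧ n' = n then
      match i with
      | 0 => 0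
      | i + 1 => ρ k' n' i + 1
    else ρ k' n' i

/-- Simultaneous renaming of predicate variables (each to one of the same kind and arity). -/
def renPred : (Kind → ℕ → ℕ → ℕ) → Formula L → Formula L
  | _, bot => bot
  | _, rel R ts => rel R ts
  | ρ, pvar k n i ts => pvar k n (ρ k n i) ts
  | ρ, imp A B => imp (renPred ρ A) (renPred ρ B)
  | ρ, allInd A => allInd (renPred ρ A)
  | ρ, allPred k n A => allPred k n (renPred (liftPredRen k n ρ) A)

/-- `A` placed under one more quantifier over predicate variables of kind `k` and arity `n`,
whose variable is not free in it. -/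
def shiftPred (k : Kind) (n : ℕ) (A : Formula L) : Formula L :=
  A.renPred fun k' n' i => if k' = k ∧ n' = n then i + 1 else i

/-! A formula `G` with parameters `x₁, …, xₙ` stands for the `n`-ary predicate
`λ x₁ … xₙ. G`: the individual indices `0, …, n - 1` of `G` are the parameters, and the
index `n + j` of `G` is the individual variable that has index `j` outside. -/

/-- The predicate that is the variable with index `i`, of kind `k` and arity `n`. -/
def predVar (k : Kind) (n i : ℕ) : Formula L :=
  pvar k n i fun a => FirstOrder.Language.Term.var a

/-- `G[t₁/x₁, …, tₙ/xₙ]`, where `x₁, …, xₙ` are the parameters of `G`. -/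
def applyPred (n : ℕ) (G : Formula L) (ts : Fin n → L.Term ℕ) : Formula L :=
  G.substInd fun j => if h : j < n then ts ⟨j, h⟩ else FirstOrder.Language.Term.var (j - n)

/-- Place predicates under one more individual quantifier (parameters are kept). -/
def liftPredInd (θ : Kind → ℕ → ℕ → Formula L) : Kind → ℕ → ℕ → Formula L :=
  fun k n i => (θ k n i).substInd fun j => FirstOrder.Language.Term.var (if j < n then j else j + 1)

/-- Extend a substitution of predicates under a quantifier of kind `k` and arity `n`. -/
def liftPred (k : Kind) (n : ℕ) (θ : Kind → ℕ → ℕ → Formula L) : Kind → ℕ → ℕ → Formula L :=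
  fun k' n' i =>
    if k' = k ∧ n' = n then
      match i with
      | 0 => predVar k' n' 0
      | i + 1 => (θ k' n' i).shiftPred k n
    else (θ k' n' i).shiftPred k n

/-- Simultaneous substitution of predicates for predicate variables. -/
def substPred : (Kind → ℕ → ℕ → Formula L) → Formula L → Formula L
  | _, bot => bot
  | _, rel R ts => rel R ts
  | θ, pvar k n i ts => applyPred n (θ k n i) ts
  | θ, imp A B => imp (substPred θ A) (substPred θ B)
  | θ, allInd A => allInd (substPred (liftPredInd θ) A)
  | θ, allPred k n A => allPred k n (substPred (liftPred k n θ) A)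

/-- `A[G/X]`, where `X` is the predicate variable of kind `k` and arity `n` with index `0` in `A`:
every `X(t₁, …, tₙ)` is replaced by `G[t₁/x₁, …, tₙ/xₙ]`. -/
def instPred (k : Kind) (n : ℕ) (A G : Formula L) : Formula L :=
  A.substPred fun k' n' i =>
    if k' = k ∧ n' = n then
      match i with
      | 0 => G
      | i + 1 => predVar k' n' i
    else predVar k' n' i

/-- The type `∀X_C {¬¬X_C → X_C}`, with `X_C` a classical variable of arity `0`. -/
def doubleNegElim : Formula L :=
  allPred Kind.classical 0
    (imp (neg (neg (pvar Kind.classical 0 0 Fin.elim0))) (pvar Kind.classical 0 0 Fin.elim0))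

end Formula

/-- `u ≈ v`: the equation `u = v` is a consequence of the set `E` of equations, whose
variables are understood as universally quantified. -/
inductive EqCons {L : FirstOrder.Language.{u, v}} (E : Set (L.Term ℕ × L.Term ℕ)) :
    L.Term ℕ → L.Term ℕ → Prop
  | ax (a b : L.Term ℕ) (σ : ℕ → L.Term ℕ) (h : (a, b) ∈ E) : EqCons E (a.subst σ) (b.subst σ)
  | refl (a : L.Term ℕ) : EqCons E a a
  | symm {a b : L.Term ℕ} (h : EqCons E a b) : EqCons E b a
  | trans {a b c : L.Term ℕ} (h : EqCons E a b) (h' : EqCons E b c) : EqCons E a c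
  | func {n : ℕ} (f : L.Functions n) (as bs : Fin n → L.Term ℕ)
      (h : ∀ i, EqCons E (as i) (bs i)) :
      EqCons E (FirstOrder.Language.Term.func f as) (FirstOrder.Language.Term.func f bs)

open Formula in
/-- The typing judgment `Γ ⊢ t : A` of the system M2, with respect to the set `E` of equations.
The type of the term variable with index `i` is the `i`-th entry of `Γ`. -/
inductive M2 {L : FirstOrder.Language.{u, v}} (E : Set (L.Term ℕ × L.Term ℕ)) :
    List (Formula L) → Tm → Formula L → Prop
  /-- The constant C has type `∀X_C {¬¬X_C → X_C}`. -/
  | control (Γ : List (Formula L)) : M2 E Γ Tm.cc doubleNegElim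
  | var {Γ : List (Formula L)} {i : ℕ} {A : Formula L} (h : Γ[i]? = some A) :
      M2 E Γ (Tm.var i) A
  | lam {Γ : List (Formula L)} {t : Tm} {A B : Formula L} (h : M2 E (A :: Γ) t B) :
      M2 E Γ (Tm.lam t) (imp A B)
  | app {Γ : List (Formula L)} {t s : Tm} {A B : Formula L}
      (h : M2 E Γ t (imp A B)) (h' : M2 E Γ s A) : M2 E Γ (Tm.app t s) B
  | allIndIntro {Γ : List (Formula L)} {t : Tm} {A : Formula L}
      (h : M2 E (Γ.map shiftInd) t A) : M2 E Γ t (allInd A)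
  | allIndElim {Γ : List (Formula L)} {t : Tm} {A : Formula L} (a : L.Term ℕ)
      (h : M2 E Γ t (allInd A)) : M2 E Γ t (A.instInd a)
  /-- Generalization over a predicate variable, ordinary or classical. -/
  | allPredIntro {Γ : List (Formula L)} {t : Tm} {A : Formula L} (k : Kind) (n : ℕ)
      (h : M2 E (Γ.map (shiftPred k n)) t A) : M2 E Γ t (allPred k n A)
  /-- An ordinary predicate variable may be instantiated by every formula. -/
  | ordinaryElim {Γ : List (Formula L)} {t : Tm} {n : ℕ} {A : Formula L} (G : Formula L)
      (h : M2 E Γ t (allPred Kind.ordinary n A)) :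
      M2 E Γ t (instPred Kind.ordinary n A G)
  /-- A classical predicate variable may be instantiated by the classical types only. -/
  | classicalElim {Γ : List (Formula L)} {t : Tm} {n : ℕ} {A : Formula L} (G : Formula L)
      (hG : G.IsClassical) (h : M2 E Γ t (allPred Kind.classical n A)) :
      M2 E Γ t (instPred Kind.classical n A G)
  | equation {Γ : List (Formula L)} {t : Tm} {A : Formula L} {a b : L.Term ℕ}
      (hab : EqCons E a b) (h : M2 E Γ t (A.instInd a)) : M2 E Γ t (A.instInd b)

end MixedLogic

/-!
The proof is a classical realizability argument carried out on *families* of terms.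

Fix a type `I` of instances. Every type is interpreted by a set of families of stacks
`I → List Tm`; a family `u : I → Tm` realizes the type when applying it pointwise to any of these
stacks lands in a *pole*, a set of families of terms closed under pointwise expansion by head
C-reduction. Since all types, and not only the classical ones, get a value of the form
"orthogonal of a set of stacks", ordinary and classical variables can be treated alike. As the
individual terms do not appear in realizers, they are ignored by the interpretation. A typable
term, seen as a constant family, realizes its type (`M2.adequacy`).

Now let `I` consist of all triples `(t, ts, y)`. The integers `m` and `j` are independent of the
triple because one pole handles all triples at once: it consists of the families that reduce,
uniformly in the triple, along a run
`p ≻ (t)V₁`, `(V₁)y₁ ≻ (t)V₂`, …, `(Vₘ)yₘ ≻ (yⱼ)ts` (`Run`), whatever index the numbering of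
the `y`'s starts from. Interpret `X_C` by the single stack `ts`. Then every `yₗ` realizes `X_C`,
hence `t` realizes `¬¬X_C`, and `(T)t ts` belongs to the pole. Reduction creates no free variables
and `T` is closed, so the conditions on free variables follow, as do `1 ≤ m` and `j ≤ m`
(look at one triple whose `t` and `ts` are closed).
-/

namespace MixedLogic

/-! ### Substitution calculus -/

namespace Tm

theorem liftRen_comp (ρ ρ' : ℕ → ℕ) :
    (fun i => liftRen ρ' (liftRen ρ i)) = liftRen (fun i => ρ' (ρ i)) := by
  funext i; cases i <;> rfl

theorem rename_rename (t : Tm) (ρ ρ' : ℕ → ℕ) :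
    (t.rename ρ).rename ρ' = t.rename fun i => ρ' (ρ i) := by
  induction t generalizing ρ ρ' with
  | var i => rfl
  | cc => rfl
  | app u v hu hv => simp [rename, hu, hv]
  | lam u hu => simp [rename, hu, liftRen_comp]

theorem subst_rename (t : Tm) (ρ : ℕ → ℕ) (σ : ℕ → Tm) :
    (t.rename ρ).subst σ = t.subst fun i => σ (ρ i) := by
  induction t generalizing ρ σ with
  | var i => rfl
  | cc => rfl
  | app u v hu hv => simp [rename, subst, hu, hv]
  | lam u hu =>
    simp only [rename, subst, hu]
    congr 2
    funext i
    cases i <;> rfl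

theorem rename_subst (t : Tm) (σ : ℕ → Tm) (ρ : ℕ → ℕ) :
    (t.subst σ).rename ρ = t.subst fun i => (σ i).rename ρ := by
  induction t generalizing ρ σ with
  | var i => rfl
  | cc => rfl
  | app u v hu hv => simp [rename, subst, hu, hv]
  | lam u hu =>
    simp only [rename, subst, hu]
    congr 2
    funext i
    cases i with
    | zero => rfl
    | succ i => simp [liftSubst, shift, rename_rename, liftRen]

theorem subst_subst (t : Tm) (σ τ : ℕ → Tm) :
    (t.subst σ).subst τ = t.subst fun i => (σ i).subst τ := by
  induction t generalizing σ τ with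
  | var i => rfl
  | cc => rfl
  | app u v hu hv => simp [subst, hu, hv]
  | lam u hu =>
    simp only [subst, hu]
    congr 2
    funext i
    cases i with
    | zero => rfl
    | succ i => simp [liftSubst, shift, subst_rename, rename_subst]

theorem subst_var (t : Tm) : t.subst var = t := by
  induction t with
  | var i => rfl
  | cc => rfl
  | app u v hu hv => simp [subst, hu, hv]
  | lam u hu =>
    have : liftSubst var = var := by funext i; cases i <;> rfl
    simp [subst, this, hu]

theorem inst_shift (t v : Tm) : t.shift.inst v = t := by
  rw [shift, inst, subst_rename]
  exact subst_var t

/-- Extend a simultaneous substitution by a term for the variable with index `0`. -/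
def consSubst (a : Tm) (σ : ℕ → Tm) : ℕ → Tm
  | 0 => a
  | i + 1 => σ i

theorem inst_subst_lift (u a : Tm) (σ : ℕ → Tm) :
    (u.subst (liftSubst σ)).inst a = u.subst (consSubst a σ) := by
  rw [inst, subst_subst]
  congr 1
  funext i
  cases i with
  | zero => rfl
  | succ i => exact inst_shift (σ i) a

theorem subst_apps (t : Tm) (ts : List Tm) (σ : ℕ → Tm) :
    (t.apps ts).subst σ = (t.subst σ).apps (ts.map (subst σ)) := by
  induction ts generalizing t with
  | nil => rfl
  | cons s ts ih => exact ih _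

theorem inst_apps_var_zero (ts : List Tm) (v : Tm) :
    ((var 0).apps (ts.map shift)).inst v = v.apps ts := by
  rw [inst, subst_apps, List.map_map]
  congr 1
  conv_rhs => rw [← List.map_id ts]
  exact List.map_congr_left fun s _ => inst_shift s v

/-! ### Free variables -/

theorem freeIn_rename {t : Tm} {ρ : ℕ → ℕ} {y : ℕ} (h : (t.rename ρ).FreeIn y) :
    ∃ x, t.FreeIn x ∧ ρ x = y := by
  induction t generalizing ρ y with
  | var i => exact ⟨i, rfl, h⟩
  | cc => exact h.elim
  | app u v hu hv =>
    rcases h with h | h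
    · obtain ⟨x, hx, e⟩ := hu h
      exact ⟨x, Or.inl hx, e⟩
    · obtain ⟨x, hx, e⟩ := hv h
      exact ⟨x, Or.inr hx, e⟩
  | lam u hu =>
    obtain ⟨x, hx, e⟩ := hu h
    cases x with
    | zero => cases e
    | succ x => exact ⟨x, hx, Nat.succ.inj e⟩

theorem freeIn_subst {t : Tm} {σ : ℕ → Tm} {y : ℕ} (h : (t.subst σ).FreeIn y) :
    ∃ x, t.FreeIn x ∧ (σ x).FreeIn y := by
  induction t generalizing σ y with
  | var i => exact ⟨i, rfl, h⟩
  | cc => exact h.elim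
  | app u v hu hv =>
    rcases h with h | h
    · obtain ⟨x, hx, e⟩ := hu h
      exact ⟨x, Or.inl hx, e⟩
    · obtain ⟨x, hx, e⟩ := hv h
      exact ⟨x, Or.inr hx, e⟩
  | lam u hu =>
    obtain ⟨x, hx, e⟩ := hu h
    cases x with
    | zero => cases e
    | succ x =>
      obtain ⟨z, hz, e'⟩ := freeIn_rename e
      cases e'
      exact ⟨x, hx, hz⟩

theorem freeIn_inst {u t : Tm} {y : ℕ} (h : (u.inst t).FreeIn y) :
    u.FreeIn (y + 1) ∨ t.FreeIn y := by
  obtain ⟨x, hx, e⟩ := freeIn_subst h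
  cases x with
  | zero => exact Or.inr e
  | succ x => cases e; exact Or.inl hx

theorem freeIn_apps {t : Tm} {ts : List Tm} {y : ℕ} :
    (t.apps ts).FreeIn y ↔ t.FreeIn y ∨ ∃ s ∈ ts, s.FreeIn y := by
  induction ts generalizing t with
  | nil => simp [apps]
  | cons s ts ih =>
    have : (t.apps (s :: ts)).FreeIn y ↔ ((t.app s).apps ts).FreeIn y := Iff.rfl
    rw [this, ih]
    simp [FreeIn, or_assoc]

end Tm

theorem HeadStep.freeIn {p q : Tm} (h : HeadStep p q) {y : ℕ} (hy : q.FreeIn y) :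
    p.FreeIn y := by
  cases h with
  | beta u t ts =>
    rw [Tm.freeIn_apps] at hy ⊢
    exact hy.imp_left Tm.freeIn_inst
  | control t ts =>
    rw [Tm.freeIn_apps]
    rcases hy with hy | hy
    · exact Or.inl (Or.inr hy)
    · rcases Tm.freeIn_apps.1 hy with hy | ⟨s', hs', hy⟩
      · cases hy
      · obtain ⟨s, hs, rfl⟩ := List.mem_map.1 hs'
        obtain ⟨x, hx, e⟩ := Tm.freeIn_rename hy
        cases e
        exact Or.inr ⟨s, hs, hx⟩

theorem HeadRed.freeIn {p q : Tm} (h : HeadRed p q) {y : ℕ} (hy : q.FreeIn y) :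
    p.FreeIn y := by
  induction h with
  | refl => exact hy
  | tail _ h ih => exact ih (h.freeIn hy)

theorem M2.lt_length_of_freeIn {L : FirstOrder.Language} {E : Set (L.Term ℕ × L.Term ℕ)}
    {Γ : List (Formula L)} {t : Tm} {A : Formula L} (h : M2 E Γ t A) {y : ℕ}
    (hy : t.FreeIn y) : y < Γ.length := by
  induction h generalizing y with
  | control Γ => exact hy.elim
  | var h => cases hy; exact (List.getElem?_eq_some_iff.1 h).1
  | lam _ ih => exact Nat.lt_of_succ_lt_succ (ih hy)
  | app _ _ ih ih' => exact hy.elim ih ih'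
  | allIndIntro _ ih => simpa using ih hy
  | allPredIntro k n _ ih => simpa using ih hy
  | allIndElim a _ ih => exact ih hy
  | ordinaryElim G _ ih => exact ih hy
  | classicalElim G hG _ ih => exact ih hy
  | equation hab _ ih => exact ih hy

/-! ### Realizability by families of terms -/

section Realizability

variable {I : Type}

/-- A pole: a set of families of terms that is closed under pointwise expansion by head
C-reduction. -/
def IsPole (Q : Set (I → Tm)) : Prop :=
  ∀ p q : I → Tm, (∀ i, HeadRed (p i) (q i)) → q ∈ Q → p ∈ Q

/-- The families of terms orthogonal to a set `S` of families of stacks: applied pointwise to a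
member of `S` they give a member of the pole. -/
def orth (Q : Set (I → Tm)) (S : Set (I → List Tm)) : Set (I → Tm) :=
  {u | ∀ π ∈ S, (fun i => (u i).apps (π i)) ∈ Q}

/-- Valuations of the predicate variables. The arguments of a predicate variable are ignored, so
that a variable of any arity has a set of families of stacks as its value. -/
abbrev Valuation (I : Type) := Kind → ℕ → ℕ → Set (I → List Tm)

/-- Extend a valuation under a quantifier of kind `k` and arity `n`. -/
def Valuation.push (k : Kind) (n : ℕ) (S : Set (I → List Tm)) (v : Valuation I) : Valuation I :=
  fun k' n' i =>
    if k' = k ∧ n' = n then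
      match i with
      | 0 => S
      | i + 1 => v k' n' i
    else v k' n' i

namespace Formula

variable {L : FirstOrder.Language}

/-- The falsity value of a type: the families of stacks against which its realizers are tested.
Individual terms play no role in it. Predicate symbols may be given any value; the empty one makes
every family of terms a realizer of an atom. -/
def falsity (Q : Set (I → Tm)) : Valuation I → Formula L → Set (I → List Tm)
  | _, bot => {fun _ => []}
  | _, rel _ _ => ∅
  | v, pvar k n i _ => v k n i
  | v, imp A B => {π | ∃ a ∈ orth Q (falsity Q v A), ∃ π' ∈ falsity Q v B,
      π = fun i => a i :: π' i}
  | v, allInd A => falsity Q v A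
  | v, allPred k n A => {π | ∃ S, π ∈ falsity Q (v.push k n S) A}

theorem falsity_substInd (Q : Set (I → Tm)) (A : Formula L) (σ : ℕ → L.Term ℕ)
    (v : Valuation I) : (A.substInd σ).falsity Q v = A.falsity Q v := by
  induction A generalizing σ v with
  | bot => rfl
  | rel R ts => rfl
  | pvar k n i ts => rfl
  | imp A B hA hB => simp [substInd, falsity, hA, hB]
  | allInd A hA => simp [substInd, falsity, hA]
  | allPred k n A hA => simp [substInd, falsity, hA]

theorem falsity_renPred (Q : Set (I → Tm)) (A : Formula L) (r : Kind → ℕ → ℕ → ℕ)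
    (v : Valuation I) :
    (A.renPred r).falsity Q v = A.falsity Q fun k n i => v k n (r k n i) := by
  induction A generalizing r v with
  | bot => rfl
  | rel R ts => rfl
  | pvar k n i ts => rfl
  | imp A B hA hB => simp [renPred, falsity, hA, hB]
  | allInd A hA => simp [renPred, falsity, hA]
  | allPred k n A hA =>
    have (S : Set (I → List Tm)) :
        (fun k' n' i => v.push k n S k' n' (liftPredRen k n r k' n' i)) =
          Valuation.push k n S fun k' n' i => v k' n' (r k' n' i) := by
      funext k' n' i
      by_cases h : k' = k ∧ n' = n
      · cases i <;> simp [Valuation.push, liftPredRen, h]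
      · simp [Valuation.push, liftPredRen, h]
    simp [renPred, falsity, hA, this]

theorem falsity_shiftPred (Q : Set (I → Tm)) (A : Formula L) (k : Kind) (n : ℕ)
    (S : Set (I → List Tm)) (v : Valuation I) :
    (A.shiftPred k n).falsity Q (v.push k n S) = A.falsity Q v := by
  rw [shiftPred, falsity_renPred]
  congr 1
  funext k' n' i
  by_cases h : k' = k ∧ n' = n <;> simp [Valuation.push, h]

theorem falsity_substPred (Q : Set (I → Tm)) (A : Formula L) (θ : Kind → ℕ → ℕ → Formula L)
    (v : Valuation I) :
    (A.substPred θ).falsity Q v = A.falsity Q fun k n i => (θ k n i).falsity Q v := by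
  induction A generalizing θ v with
  | bot => rfl
  | rel R ts => rfl
  | pvar k n i ts => exact falsity_substInd Q _ _ v
  | imp A B hA hB => simp [substPred, falsity, hA, hB]
  | allInd A hA => simp [substPred, falsity, hA, liftPredInd, falsity_substInd]
  | allPred k n A hA =>
    have (S : Set (I → List Tm)) :
        (fun k' n' i => (liftPred k n θ k' n' i).falsity Q (v.push k n S)) =
          Valuation.push k n S fun k' n' i => (θ k' n' i).falsity Q v := by
      funext k' n' i
      by_cases h : k' = k ∧ n' = n
      · obtain ⟨rfl, rfl⟩ := h
        cases i with
        | zero => simp [Valuation.push, liftPred, predVar, falsity]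
        | succ i => simp [Valuation.push, liftPred, falsity_shiftPred]
      · simp [Valuation.push, liftPred, h, falsity_shiftPred]
    simp [substPred, falsity, hA, this]

theorem falsity_instPred (Q : Set (I → Tm)) (A G : Formula L) (k : Kind) (n : ℕ)
    (v : Valuation I) :
    (instPred k n A G).falsity Q v = A.falsity Q (v.push k n (G.falsity Q v)) := by
  rw [instPred, falsity_substPred]
  congr 1
  funext k' n' i
  by_cases h : k' = k ∧ n' = n
  · cases i <;> simp [Valuation.push, h, predVar, falsity]
  · simp [Valuation.push, h, predVar, falsity]

/-- The constant C realizes double negation elimination: the continuation that it makes out of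
a stack `π` realizes `¬X` as soon as `π` belongs to the value of `X`. -/
theorem control_mem_orth {Q : Set (I → Tm)} (hQ : IsPole Q) (v : Valuation I) :
    (fun _ => Tm.cc) ∈ orth Q ((doubleNegElim : Formula L).falsity Q v) := by
  rintro _ ⟨S, u, hu, π, hπ, rfl⟩
  have hπ : π ∈ S := by simpa [falsity, Valuation.push] using hπ
  refine hQ _ (fun i => (u i).app (.lam ((Tm.var 0).apps ((π i).map Tm.shift))))
    (fun i => .single (.control (u i) (π i))) ?_
  refine hu (fun i => [.lam ((Tm.var 0).apps ((π i).map Tm.shift))])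
    ⟨_, ?_, fun _ => [], rfl, rfl⟩
  rintro _ ⟨w, hw, _, rfl, rfl⟩
  refine hQ _ (fun i => (w i).apps (π i)) (fun i => .single ?_) (hw π ?_)
  · have := HeadStep.beta ((Tm.var 0).apps ((π i).map Tm.shift)) (w i) []
    rwa [Tm.inst_apps_var_zero] at this
  · simpa [falsity, Valuation.push] using hπ

end Formula

open Formula in
/-- Adequacy: a typable term whose free variables are replaced by realizers of the types of the
context realizes its type. -/
theorem M2.adequacy {L : FirstOrder.Language} {E : Set (L.Term ℕ × L.Term ℕ)}
    {Γ : List (Formula L)} {t : Tm} {A : Formula L} (h : M2 E Γ t A)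
    {Q : Set (I → Tm)} (hQ : IsPole Q) (v : Valuation I) (σ : I → ℕ → Tm)
    (hσ : ∀ n B, Γ[n]? = some B → (fun i => σ i n) ∈ orth Q (B.falsity Q v)) :
    (fun i => t.subst (σ i)) ∈ orth Q (A.falsity Q v) := by
  induction h generalizing v σ with
  | control Γ => exact control_mem_orth hQ v
  | var h => exact hσ _ _ h
  | @lam Γ t A B _ ih =>
    rintro _ ⟨a, ha, π, hπ, rfl⟩
    refine hQ _ (fun i => (t.subst (Tm.consSubst (a i) (σ i))).apps (π i))
      (fun i => .single ?_) (ih v (fun i => Tm.consSubst (a i) (σ i)) ?_ π hπ)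
    · rw [← Tm.inst_subst_lift]
      exact .beta _ _ _
    · intro n B hB
      cases n with
      | zero =>
        obtain rfl : A = B := by simpa using hB
        exact ha
      | succ n => exact hσ n B (by simpa using hB)
  | app _ _ ih ih' =>
    intro π hπ
    exact ih v σ hσ _ ⟨_, ih' v σ hσ, π, hπ, rfl⟩
  | allIndIntro _ ih =>
    refine ih v σ fun n B hB => ?_
    rw [List.getElem?_map, Option.map_eq_some_iff] at hB
    obtain ⟨B, hB, rfl⟩ := hB
    rw [shiftInd, falsity_substInd]
    exact hσ n B hB
  | allIndElim a _ ih =>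
    rw [instInd, falsity_substInd]
    exact ih v σ hσ
  | allPredIntro k n _ ih =>
    rintro π ⟨S, hπ⟩
    refine ih (v.push k n S) σ (fun n B hB => ?_) π hπ
    rw [List.getElem?_map, Option.map_eq_some_iff] at hB
    obtain ⟨B, hB, rfl⟩ := hB
    rw [falsity_shiftPred]
    exact hσ n B hB
  | ordinaryElim G _ ih =>
    intro π hπ
    rw [falsity_instPred] at hπ
    exact ih v σ hσ π ⟨_, hπ⟩
  | classicalElim G _ _ ih =>
    intro π hπ
    rw [falsity_instPred] at hπ
    exact ih v σ hσ π ⟨_, hπ⟩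
  | equation _ _ ih =>
    have := ih v σ hσ
    rw [instInd, falsity_substInd] at this ⊢
    exact this

end Realizability

/-! ### Uniform runs -/

section Runs

variable {I : Type} (t : I → Tm) (ts : I → List Tm) (y : I → ℕ → ℕ)

/-- `Run t ts y k p`: the families of terms `p` reduces, with the same shape for all members of
the family, as `p ≻ (t)Vₖ₊₁`, `(Vₖ₊₁)yₖ₊₁ ≻ (t)Vₖ₊₂`, … until some `(yⱼ)ts` is reached. -/
inductive Run : ℕ → (I → Tm) → Prop
  | done {k : ℕ} {p : I → Tm} (j : ℕ) (hj : 1 ≤ j)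
      (h : ∀ i, HeadRed (p i) ((Tm.var (y i j)).apps (ts i))) : Run k p
  | step {k : ℕ} {p : I → Tm} (V : I → Tm) (h : ∀ i, HeadRed (p i) ((t i).app (V i)))
      (hV : Run (k + 1) fun i => (V i).app (.var (y i (k + 1)))) : Run k p

/-- The pole of the families that have a run from every starting index. The quantification over
the index lets each application of `t` pick the next variable, whichever come before it. -/
def runPole : Set (I → Tm) := {p | ∀ k, Run t ts y k p}

theorem isPole_runPole : IsPole (runPole t ts y) := by
  intro p q h hq k
  cases hq k with
  | done j hj hr => exact .done j hj fun i => (h i).trans (hr i)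
  | step V hr hV => exact .step V (fun i => (h i).trans (hr i)) hV

variable {t ts y}

/-- A realizer of double negation elimination, applied to `t` and the stack `ts`, has a run:
for `X` interpreted by the single stack `ts`, all `yⱼ` realize `X` and so `t` realizes `¬¬X`. -/
theorem run_of_mem_orth {L : FirstOrder.Language} {v : Valuation I} {T : I → Tm}
    (hT : T ∈ orth (runPole t ts y)
      ((Formula.doubleNegElim : Formula L).falsity (runPole t ts y) v)) :
    Run t ts y 0 fun i => ((T i).app (t i)).apps (ts i) := by
  refine hT (fun i => t i :: ts i) ⟨{ts}, t, ?_, ts, ?_, rfl⟩ 0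
  · rintro _ ⟨V, hV, _, rfl, rfl⟩ k
    refine .step V (fun i => .refl) ?_
    refine hV (fun i => [.var (y i (k + 1))]) ⟨_, ?_, fun _ => [], rfl, rfl⟩ (k + 1)
    intro π hπ l
    have hπ : π = ts := by simpa [Formula.falsity, Valuation.push] using hπ
    subst hπ
    exact .done (k + 1) (Nat.le_add_left 1 k) fun i => .refl
  · simp [Formula.falsity, Valuation.push]

/-- A run as a sequence: `P i` is its `i`-th stage, from which `(t)Vᵢ₊₁` is reached. -/
theorem Run.exists_seq {k : ℕ} {p : I → Tm} (h : Run t ts y k p) :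
    ∃ (m j : ℕ) (P V : ℕ → I → Tm), k ≤ m ∧ 1 ≤ j ∧ P k = p ∧
      (∀ l, k ≤ l → l < m → ∀ i, HeadRed (P l i) ((t i).app (V (l + 1) i)) ∧
        P (l + 1) i = (V (l + 1) i).app (.var (y i (l + 1)))) ∧
      ∀ i, HeadRed (P m i) ((Tm.var (y i j)).apps (ts i)) := by
  induction h with
  | @done k p j hj h =>
    exact ⟨k, j, fun _ => p, fun _ => p, le_rfl, hj, rfl, fun l h h' => by omega, h⟩
  | @step k p U h _ ih =>
    obtain ⟨m, j, P, V, hm, hj, hP, hstep, hend⟩ := ih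
    refine ⟨m, j, Function.update P k p, Function.update V (k + 1) U, by omega, hj, by simp,
      fun l hl hlm i => ?_, fun i => ?_⟩
    · rcases hl.eq_or_lt with rfl | hl
      · simp [h i, hP]
      · simpa [Function.update_of_ne (show l ≠ k by omega),
          Function.update_of_ne (show l + 1 ≠ k by omega),
          Function.update_of_ne (show l + 1 ≠ k + 1 by omega)] using hstep l hl hlm i
    · rw [Function.update_of_ne (by omega)]
      exact hend i

end Runs

end MixedLogic

/-- The free variables of the `l`-th stage of a run that starts with `(T)t ts`, for a closed `T`,
are free in `t` or `ts` or among the variables `y₁, …, yₗ` used so far. -/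
theorem MixedLogic.freeIn_stage {T t : Tm} {ts : List Tm} {y : ℕ → ℕ} {m : ℕ} {P V : ℕ → Tm}
    (hT : ∀ z, ¬ T.FreeIn z) (h0 : P 0 = (T.app t).apps ts)
    (hstep : ∀ l < m, HeadRed (P l) (t.app (V (l + 1))) ∧
      P (l + 1) = (V (l + 1)).app (.var (y (l + 1)))) {l : ℕ} (hl : l ≤ m) {z : ℕ}
    (hz : (P l).FreeIn z) :
    (t.FreeIn z ∨ ∃ s ∈ ts, s.FreeIn z) ∨ ∃ i, 1 ≤ i ∧ i ≤ l ∧ y i = z := by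
  induction l with
  | zero =>
    rw [h0, Tm.freeIn_apps] at hz
    rcases hz with (hz | hz) | hz
    · exact (hT z hz).elim
    · exact .inl (.inl hz)
    · exact .inl (.inr hz)
  | succ l ih =>
    rw [(hstep l hl).2] at hz
    rcases hz with hz | hz
    · rcases ih (by omega) ((hstep l hl).1.freeIn (Or.inr hz)) with h | ⟨i, h1, h2, h3⟩
      · exact .inl h
      · exact .inr ⟨i, h1, by omega, h3⟩
    · exact .inr ⟨l + 1, by omega, le_rfl, hz⟩

theorem theorem7p2 {L : FirstOrder.Language} (E : Set (L.Term ℕ × L.Term ℕ))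
    (T : MixedLogic.Tm) (hT : MixedLogic.M2 E [] T MixedLogic.Formula.doubleNegElim) :
    ∃ m j : ℕ, 1 ≤ j ∧ j ≤ m ∧
      ∀ (t : MixedLogic.Tm) (ts : List MixedLogic.Tm) (y : ℕ → ℕ),
        -- the variables y 1, ..., y m are distinct and do not occur in t, t_1, ..., t_n
        Set.InjOn y (Set.Icc 1 m) →
        (∀ i ∈ Set.Icc 1 m, ¬ t.FreeIn (y i) ∧ ∀ s ∈ ts, ¬ s.FreeIn (y i)) →
        ∃ V : ℕ → MixedLogic.Tm,
          -- y i is new with respect to V 1, ..., V i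
          (∀ i k : ℕ, 1 ≤ i → i ≤ k → k ≤ m → ¬ (V i).FreeIn (y k)) ∧
          MixedLogic.HeadRed ((T.app t).apps ts) (t.app (V 1)) ∧
          (∀ i : ℕ, 1 ≤ i → i < m →
            MixedLogic.HeadRed ((V i).app (.var (y i))) (t.app (V (i + 1)))) ∧
          MixedLogic.HeadRed ((V m).app (.var (y m)))
            ((MixedLogic.Tm.var (y j)).apps ts) := by
  have hclosed : ∀ z, ¬ T.FreeIn z := fun z hz => by simpa using hT.lt_length_of_freeIn hz
  -- An instance is a triple `(t, ts, y)`; no condition on free variables is imposed on it.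
  let I := MixedLogic.Tm × List MixedLogic.Tm × (ℕ → ℕ)
  have hmem := hT.adequacy (MixedLogic.isPole_runPole (I := I) (·.1) (·.2.1) (·.2.2))
    (fun _ _ _ => ∅) (fun _ => MixedLogic.Tm.var) (by simp)
  simp only [MixedLogic.Tm.subst_var] at hmem
  obtain ⟨m, j, P, V, -, hj, hP, hstep, hend⟩ := (MixedLogic.run_of_mem_orth hmem).exists_seq
  have hfree (i : I) (l : ℕ) (hl : l ≤ m) (z : ℕ) (hz : (P l i).FreeIn z) :=
    MixedLogic.freeIn_stage (P := (P · i)) (V := (V · i)) hclosed (congrFun hP i)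
      (fun l hl => hstep l l.zero_le hl i) hl hz
  have hjm : j ≤ m := by
    -- With `t = C`, `ts` empty and `y` the identity, only `y₁, …, yₘ` can be free at the end.
    let i₀ : I := (.cc, [], id)
    have hyj : (P m i₀).FreeIn j := (hend i₀).freeIn rfl
    rcases hfree i₀ m le_rfl j hyj with (h | ⟨s, hs, -⟩) | ⟨i, -, him, hi⟩
    · exact h.elim
    · cases hs
    · exact hi ▸ him
  refine ⟨m, j, hj, hjm, fun t ts y hy hfresh => ?_⟩
  let i₀ : I := (t, ts, y)
  refine ⟨fun l => V l i₀, fun i k hi hik hkm hk => ?_, ?_, fun l hl hlm => ?_, ?_⟩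
  · obtain ⟨l, rfl⟩ := Nat.exists_eq_add_of_le' hi
    have hPl : (P l i₀).FreeIn (y k) := (hstep l l.zero_le (by omega) i₀).1.freeIn (Or.inr hk)
    have hkI : k ∈ Set.Icc 1 m := ⟨by omega, hkm⟩
    rcases hfree i₀ l (by omega) _ hPl with (h | ⟨s, hs, h⟩) | ⟨i, h1, h2, h3⟩
    · exact (hfresh k hkI).1 h
    · exact (hfresh k hkI).2 s hs h
    · have := hy ⟨h1, by omega⟩ hkI h3
      omega
  · have := (hstep 0 le_rfl (by omega) i₀).1
    rwa [hP] at this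
  · obtain ⟨n, rfl⟩ := Nat.exists_eq_add_of_le' hl
    rw [← (hstep n n.zero_le (by omega) i₀).2]
    exact (hstep (n + 1) (by omega) hlm i₀).1
  · obtain ⟨n, rfl⟩ := Nat.exists_eq_add_of_le' (hj.trans hjm)
    rw [← (hstep n n.zero_le (by omega) i₀).2]
    exact hend i₀
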